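/- Let $\mathrm{PL}_o([0,\infty))$ be the group, under composition $(gh)(t)=g(h(t))$, of all orientation preserving piecewise linear homeomorphisms $g$ of $\mathbb{R}$ with finitely many break points and with support $\{t\mid g(t)\ne t\}$ contained in $[0,\infty)$. For such $g$ let $\sigma_\ell(g)>0$ be the right derivative of $g$ at $0$, and let $\rho(g)$ be the unique affine homeomorphism of $\mathbb{R}$ that coincides with $g$ near $\infty$; both $\sigma_\ell$ and $\rho$ are homomorphisms. For a group $G$ let $S(G)$ be the set of rays $[\chi]=\mathbb{R}_{>0}\cdot\chi$ of non-zero homomorphisms $\chi\colon G\to(\mathbb{R},+)$. Define $\Sigma^1(G)\subseteq S(G)$ to be the set of those $[\chi]$ for which, for every generating set $\mathcal{X}$ of $G$, the full subgraph on the vertex set $G_\chi=\{g\in G\mid\chi(g)\ge 0\}$ of the Cayley graph with vertices $g\in G$ and edges $(g,gx)$, $x\in\mathcal{X}$, is connected. **Theorem 1.2.** Let $G$ be a subgroup of $\mathrm{PL}_o([0,\infty))$ such that $\rho(g)$ is a translation for every $g\in G$. Let $\chi_\ell\colon G\to\mathbb{R}$ be the homomorphism $g\mapsto\ln\sigma_\ell(g)$,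 and let $\tau_r\colon G\to\mathbb{R}$ be the homomorphism sending $g$ to the amplitude $\rho(g)(0)$ of the translation $\rho(g)$. Let $E(G)$ be the subset of $S(G)$ consisting of the rays of those among $\chi_\ell$ and $-\tau_r$ that are non-zero. If $G$ is irreducible, that is, if no point of $(0,\infty)$ is fixed by all of $G$, and if the quotient group $G/(\ker\sigma_\ell|_G\cdot\ker\tau_r)$ is a torsion group, then $$\Sigma^1(G)=S(G)\smallsetminus E(G).$$ -/

import Mathlib

noncomputable section

namespace PLHomeo

open Filter Topology

/-! ### Finitary piecewise linear homeomorphisms of the real line -/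

/-- A map `f : ℝ → ℝ` is (finitary) piecewise linear if there is a finite set `B` of break points
such that `f` is given by an affine formula `x ↦ p * x + q` on every interval missing `B`
(the intervals of `ℝ` are its preconnected subsets). -/
def IsFinitaryPL (f : ℝ → ℝ) : Prop :=
  ∃ B : Set ℝ, B.Finite ∧ ∀ s : Set ℝ, IsPreconnected s → Disjoint s B →
    ∃ p q : ℝ, ∀ x ∈ s, f x = p * x + q

theorem IsFinitaryPL.id : IsFinitaryPL (fun x => x) :=
  ⟨∅, Set.finite_empty, fun _ _ _ => ⟨1, 0, fun x _ => by ring⟩⟩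

theorem IsFinitaryPL.mul {f g : ℝ ≃ₜ ℝ} (hf : IsFinitaryPL f) (hg : IsFinitaryPL g) :
    IsFinitaryPL (f * g : ℝ ≃ₜ ℝ) := by
  obtain ⟨B, hB, hfB⟩ := hf
  obtain ⟨C, hC, hgC⟩ := hg
  refine ⟨C ∪ g ⁻¹' B, hC.union (hB.preimage g.injective.injOn), fun s hs hd => ?_⟩
  rw [Set.disjoint_union_right] at hd
  obtain ⟨p, q, hpq⟩ := hgC s hs hd.1
  obtain ⟨p', q', hpq'⟩ := hfB (g '' s) (hs.image _ g.continuous.continuousOn) (by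
    rw [Set.disjoint_left]
    rintro _ ⟨x, hx, rfl⟩ hxB
    exact Set.disjoint_left.1 hd.2 hx hxB)
  refine ⟨p' * p, p' * q + q', fun x hx => ?_⟩
  rw [Homeomorph.mul_apply, hpq' _ ⟨x, hx, rfl⟩, hpq x hx]
  ring

theorem IsFinitaryPL.inv {f : ℝ ≃ₜ ℝ} (hf : IsFinitaryPL f) :
    IsFinitaryPL (f⁻¹ : ℝ ≃ₜ ℝ) := by
  obtain ⟨B, hB, hfB⟩ := hf
  refine ⟨f '' B, hB.image f, fun s hs hd => ?_⟩
  obtain ⟨p, q, hpq⟩ := hfB (f.symm '' s) (hs.image _ f.symm.continuous.continuousOn) (by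
    rw [Set.disjoint_left]
    rintro _ ⟨x, hx, rfl⟩ hxB
    exact Set.disjoint_left.1 hd hx ⟨_, hxB, f.apply_symm_apply x⟩)
  have key : ∀ x ∈ s, x = p * f.symm x + q := fun x hx => by
    rw [← hpq _ ⟨x, hx, rfl⟩, f.apply_symm_apply]
  by_cases hp : p = 0
  · refine ⟨0, f.symm q, fun x hx => ?_⟩
    have h := key x hx
    rw [hp, zero_mul, zero_add] at h
    change f.symm x = _
    rw [h]; ring
  · refine ⟨p⁻¹, -(p⁻¹ * q), fun x hx => ?_⟩
    have h := key x hx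
    change f.symm x = _
    field_simp
    linarith

/-- `PLo I` is the group `PL_o(I)` of all orientation preserving, finitary piecewise linear
homeomorphisms of `ℝ` whose support `{t | g t ≠ t}` is contained in `I`.  The product is
composition of functions, `(g * h) t = g (h t)`. -/
def PLo (I : Set ℝ) : Subgroup (ℝ ≃ₜ ℝ) where
  carrier := {g | StrictMono g ∧ IsFinitaryPL g ∧ {t : ℝ | g t ≠ t} ⊆ I}
  one_mem' := ⟨strictMono_id, IsFinitaryPL.id, fun _ ht => absurd rfl ht⟩
  mul_mem' := by
    rintro f g ⟨hf, hf', hf''⟩ ⟨hg, hg', hg''⟩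
    refine ⟨hf.comp hg, hf'.mul hg', fun t ht => ?_⟩
    by_contra hI
    have h1 : g t = t := by by_contra h; exact hI (hg'' h)
    have h2 : f t = t := by by_contra h; exact hI (hf'' h)
    exact ht (by rw [Homeomorph.mul_apply, h1, h2])
  inv_mem' := by
    rintro f ⟨hf, hf', hf''⟩
    refine ⟨fun a b hab => ?_, hf'.inv, fun t ht => ?_⟩
    · change f.symm a < f.symm b
      rw [← hf.lt_iff_lt, f.apply_symm_apply, f.apply_symm_apply]
      exact hab
    · by_contra hI
      have h2 : f t = t := by by_contra h; exact hI (hf'' h)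
      refine ht ?_
      change f.symm t = t
      rw [Homeomorph.symm_apply_eq, h2]

/-- A subgroup `G` of `PL_o(I)` is irreducible if it has no fixed point in the interior of `I`. -/
def IsIrreducible {I : Set ℝ} (G : Subgroup (PLo I)) : Prop :=
  ∀ t ∈ interior I, ∃ g ∈ G, (g : ℝ ≃ₜ ℝ) t ≠ t

/-- The group `PL_o([0, ∞))`. -/
abbrev PLHalf : Subgroup (ℝ ≃ₜ ℝ) := PLo (Set.Ici 0)

/-! ### The homomorphism `σ_ℓ`: right derivative at the end point `0` -/

theorem map_zero_of_mem (g : PLHalf) : (g : ℝ ≃ₜ ℝ) 0 = 0 := by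
  obtain ⟨g, hm, -, hs⟩ := g
  have h : ∀ t < 0, g t = t := fun t ht => by
    by_contra h
    exact absurd (hs h) (not_le.2 ht)
  have h1 : Tendsto g (𝓝[<] 0) (𝓝 (g 0)) := g.continuous.continuousAt.tendsto.mono_left inf_le_left
  have h2 : Tendsto g (𝓝[<] 0) (𝓝 0) := by
    refine Tendsto.congr' (f₁ := fun t => t) ?_ (tendsto_id.mono_left inf_le_left)
    filter_upwards [self_mem_nhdsWithin] with t ht using (h t ht).symm
  exact tendsto_nhds_unique h1 h2

theorem exists_pos_eventually_right (g : PLHalf) :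
    ∃ p : ℝ, 0 < p ∧ ∀ᶠ t in 𝓝[≥] (0 : ℝ), (g : ℝ ≃ₜ ℝ) t = p * t := by
  have h0 : (g : ℝ ≃ₜ ℝ) 0 = 0 := map_zero_of_mem g
  obtain ⟨hm, ⟨B, hB, hgB⟩, -⟩ := g.2
  generalize (g : ℝ ≃ₜ ℝ) = g at *
  obtain ⟨ε, hε, hεB⟩ : ∃ ε > 0, Disjoint (Set.Ioo 0 ε) B := by
    have : ((B \ {0})ᶜ : Set ℝ) ∈ 𝓝 (0 : ℝ) :=
      (hB.subset Set.sdiff_subset).isClosed.isOpen_compl.mem_nhds (by simp)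
    obtain ⟨ε, hε, h⟩ := Metric.mem_nhds_iff.1 this
    refine ⟨ε, hε, Set.disjoint_left.2 fun x hx hxB => h (?_ : x ∈ Metric.ball 0 ε) ⟨hxB, hx.1.ne'⟩⟩
    rw [Metric.mem_ball, Real.dist_eq, sub_zero, abs_of_pos hx.1]
    exact hx.2
  obtain ⟨p, q, hpq⟩ := hgB _ isPreconnected_Ioo hεB
  have hev : ∀ᶠ t in 𝓝[>] (0 : ℝ), g t = p * t + q := by
    filter_upwards [Ioo_mem_nhdsGT hε] with t ht using hpq t ht
  have hq : q = 0 := by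
    have h1 : Tendsto g (𝓝[>] 0) (𝓝 (g 0)) :=
      g.continuous.continuousAt.tendsto.mono_left inf_le_left
    have h2 : Tendsto g (𝓝[>] 0) (𝓝 (p * 0 + q)) := by
      refine Tendsto.congr' (f₁ := fun t => p * t + q) ?_ ?_
      · filter_upwards [hev] with t ht using ht.symm
      · exact (Continuous.tendsto (by fun_prop) 0).mono_left inf_le_left
    have := tendsto_nhds_unique h1 h2
    rw [h0] at this
    linarith
  refine ⟨p, ?_, ?_⟩
  · have h1 := hpq (ε / 2) ⟨by positivity, by linarith⟩
    have h2 : g 0 < g (ε / 2) := hm (by positivity)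
    rw [h0, h1, hq, add_zero] at h2
    by_contra hp
    have : p * (ε / 2) ≤ 0 := mul_nonpos_of_nonpos_of_nonneg (not_lt.1 hp) (by positivity)
    linarith
  · filter_upwards [Ico_mem_nhdsGE hε] with t ht
    rcases ht.1.eq_or_lt with h | h
    · rw [← h]; simp [h0]
    · rw [hpq t ⟨h, ht.2⟩, hq, add_zero]

theorem exists_pos_hasDerivWithinAt (g : PLHalf) :
    ∃ p : ℝ, 0 < p ∧ HasDerivWithinAt (g : ℝ ≃ₜ ℝ) p (Set.Ici 0) 0 := by
  obtain ⟨p, hp, h⟩ := exists_pos_eventually_right g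
  refine ⟨p, hp, ?_⟩
  have h1 : HasDerivWithinAt (fun t : ℝ => p * t) p (Set.Ici 0) 0 := by
    simpa using ((hasDerivAt_id (0 : ℝ)).const_mul p).hasDerivWithinAt
  exact h1.congr_of_eventuallyEq h (by rw [map_zero_of_mem]; simp)

theorem hasDerivWithinAt_zero (g : PLHalf) :
    HasDerivWithinAt (g : ℝ ≃ₜ ℝ) (derivWithin (g : ℝ ≃ₜ ℝ) (Set.Ici 0) 0) (Set.Ici 0) 0 :=
  (exists_pos_hasDerivWithinAt g).choose_spec.2.differentiableWithinAt.hasDerivWithinAt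

theorem derivWithin_zero_pos (g : PLHalf) :
    0 < derivWithin (g : ℝ ≃ₜ ℝ) (Set.Ici 0) 0 := by
  obtain ⟨p, hp, h⟩ := exists_pos_hasDerivWithinAt g
  rwa [h.derivWithin (uniqueDiffOn_Ici 0 0 Set.self_mem_Ici)]

/-- The homomorphism `σ_ℓ` of `PL_o([0, ∞))` into the multiplicative group of the positive reals,
sending `g` to its right derivative at `0`. -/
def sigmaL : PLHalf →* {x : ℝ // 0 < x} where
  toFun g := ⟨derivWithin (g : ℝ ≃ₜ ℝ) (Set.Ici 0) 0, derivWithin_zero_pos g⟩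
  map_one' := by
    apply Subtype.ext
    exact (hasDerivWithinAt_id (0 : ℝ) (Set.Ici 0)).derivWithin
      (uniqueDiffOn_Ici 0 0 Set.self_mem_Ici)
  map_mul' f g := by
    apply Subtype.ext
    have hg := hasDerivWithinAt_zero g
    have hf := hasDerivWithinAt_zero f
    rw [← map_zero_of_mem g] at hf
    have hmaps : Set.MapsTo (g : ℝ ≃ₜ ℝ) (Set.Ici 0) (Set.Ici ((g : ℝ ≃ₜ ℝ) 0)) :=
      fun t ht => g.2.1.monotone ht
    have := HasDerivWithinAt.comp (0 : ℝ) hf hg (by rwa [map_zero_of_mem g] at hmaps ⊢)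
    have h := this.derivWithin (uniqueDiffOn_Ici 0 0 Set.self_mem_Ici)
    rw [map_zero_of_mem g] at h
    exact h

/-! ### The homomorphism `ρ`: germ at infinity -/

theorem exists_affine_atTop (g : PLHalf) :
    ∃ e : ℝ ≃ᵃ[ℝ] ℝ, ∀ᶠ t in atTop, (g : ℝ ≃ₜ ℝ) t = e t := by
  obtain ⟨g, hm, ⟨B, hB, hgB⟩, -⟩ := g
  obtain ⟨M, hM⟩ := hB.bddAbove
  obtain ⟨p, q, hpq⟩ := hgB (Set.Ioi M) isPreconnected_Ioi
    (Set.disjoint_left.2 fun x hx hxB => absurd (hM hxB) (not_le.2 hx))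
  have hp : p ≠ 0 := by
    rintro rfl
    have h1 := hpq (M + 1) (by simp)
    have h2 := hpq (M + 2) (by simp)
    have h3 : g (M + 1) < g (M + 2) := hm (by linarith)
    rw [h1, h2] at h3
    linarith
  refine ⟨(LinearEquiv.smulOfNeZero ℝ ℝ p hp).toAffineEquiv.trans (AffineEquiv.constVAdd ℝ ℝ q), ?_⟩
  filter_upwards [eventually_gt_atTop M] with t ht
  change g t = q + p * t
  rw [hpq t ht]
  ring

theorem affineEquiv_eq_of_eventuallyEq {e e' : ℝ ≃ᵃ[ℝ] ℝ}
    (h : ∀ᶠ t in atTop, e t = e' t) : e = e' := by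
  obtain ⟨M, hM⟩ := eventually_atTop.1 h
  have hl : ∀ (a : ℝ ≃ᵃ[ℝ] ℝ) (t : ℝ), a t = (a (M + 1) - a M) * (t - M) + a M := by
    intro a t
    have h1 := a.map_vadd M (t - M)
    have h2 := a.map_vadd M 1
    have h3 : a.linear (t - M) = (t - M) * a.linear 1 := by
      rw [← smul_eq_mul, ← map_smul, smul_eq_mul, mul_one]
    simp only [vadd_eq_add] at h1 h2
    rw [sub_add_cancel] at h1
    rw [add_comm M 1, h1, h2, h3]
    ring
  ext t
  rw [hl e t, hl e' t, hM M le_rfl, hM (M + 1) (by linarith)]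

/-- The homomorphism `ρ` of `PL_o([0, ∞))` into the affine group of `ℝ`, sending `g` to the
unique affine bijection of `ℝ` that coincides with `g` near `∞` (it is automatically
increasing, as `g` is). -/
def rho : PLHalf →* (ℝ ≃ᵃ[ℝ] ℝ) where
  toFun g := (exists_affine_atTop g).choose
  map_one' := affineEquiv_eq_of_eventuallyEq <| by
    filter_upwards [(exists_affine_atTop 1).choose_spec] with t ht
    rw [← ht]; rfl
  map_mul' f g := affineEquiv_eq_of_eventuallyEq <| by
    have hg : Tendsto (g : ℝ ≃ₜ ℝ) atTop atTop :=
      g.2.1.monotone.tendsto_atTop_atTop fun b =>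
        ⟨(g : ℝ ≃ₜ ℝ).symm b, ((g : ℝ ≃ₜ ℝ).apply_symm_apply b).ge⟩
    filter_upwards [(exists_affine_atTop (f * g)).choose_spec,
      (exists_affine_atTop g).choose_spec,
      hg.eventually (exists_affine_atTop f).choose_spec] with t h1 h2 h3
    rw [← h1, AffineEquiv.mul_def, AffineEquiv.trans_apply, ← h2, ← h3]
    rfl

theorem rho_spec (g : PLHalf) : ∀ᶠ t in atTop, (g : ℝ ≃ₜ ℝ) t = rho g t :=
  (exists_affine_atTop g).choose_spec

/-- An affine bijection of `ℝ` is a translation if it is of the form `t ↦ c + t`. -/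
def IsTranslation (e : ℝ ≃ᵃ[ℝ] ℝ) : Prop :=
  ∃ c : ℝ, e = AffineEquiv.constVAdd ℝ ℝ c

/-! ### Characters, the sphere `S(G)` and the invariant `Σ¹(G)` -/

/-- The real vector space `Hom(G, ℝ)` of homomorphisms of `G` into the additive group of `ℝ`. -/
abbrev Character (G : Type*) [Group G] : Type _ := Additive G →+ ℝ

/-- `S(G)`: the set of all rays `[χ] = ℝ_{>0} · χ`, with `χ` a non-zero character of `G`. -/
abbrev CharSphere (G : Type*) [Group G] : Type _ := Module.Ray ℝ (Character G)

/-- The submonoid `G_χ = {g | χ(g) ≥ 0}`, as a set. -/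
def nonnegSet {G : Type*} [Group G] (χ : Character G) : Set G :=
  {g | 0 ≤ χ (Additive.ofMul g)}

/-- The full subgraph `Γ(G, X)_χ`, with vertex set `G_χ`, of the Cayley graph `Γ(G, X)`, the latter
with vertex set `G` and edges from `g` to `g * x` for `x ∈ X`. -/
def cayleySubgraph {G : Type*} [Group G] (X : Set G) (χ : Character G) :
    SimpleGraph (nonnegSet χ) :=
  (SimpleGraph.mulCayley X).induce (nonnegSet χ)

/-- The invariant `Σ¹(G)`: the rays `[χ]` for which `Γ(G, X)_χ` is connected for every generating
set `X` of `G`. -/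
def Sigma1 (G : Type*) [Group G] : Set (CharSphere G) :=
  {r | ∃ (χ : Character G) (hχ : χ ≠ 0), r = rayOfNeZero ℝ χ hχ ∧
    ∀ X : Set G, Subgroup.closure X = ⊤ → (cayleySubgraph X χ).Connected}

/-- Membership of `[χ]` in `Σ¹(G)` can be tested on the representative `χ`. -/
theorem rayOfNeZero_mem_Sigma1 {G : Type*} [Group G] (χ : Character G) (hχ : χ ≠ 0) :
    rayOfNeZero ℝ χ hχ ∈ Sigma1 G ↔
      ∀ X : Set G, Subgroup.closure X = ⊤ → (cayleySubgraph X χ).Connected := by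
  refine ⟨?_, fun h => ⟨χ, hχ, rfl, h⟩⟩
  rintro ⟨ψ, hψ, hr, h⟩ X hX
  obtain ⟨c, hc, hcψ⟩ := ((ray_eq_iff hχ hψ).1 hr).exists_pos_left hχ hψ
  have hset : nonnegSet ψ = nonnegSet χ := by
    ext g
    simp only [nonnegSet, Set.mem_ofPred_eq, ← hcψ]
    exact mul_nonneg_iff_of_pos_left hc
  have h' := h X hX
  unfold cayleySubgraph at h' ⊢
  rwa [hset] at h'

/-! ### The characters `χ_ℓ` and `τ_r` of a subgroup of `PL_o([0, ∞))` -/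

/-- The character `χ_ℓ = ln ∘ σ_ℓ` of `G`. -/
def chiL (G : Subgroup PLHalf) : Character G where
  toFun g := Real.log (sigmaL (Additive.toMul g : G)).1
  map_zero' := by
    rw [toMul_zero, OneMemClass.coe_one, map_one]
    exact Real.log_one
  map_add' g h := by
    rw [toMul_add, Subgroup.coe_mul, map_mul]
    exact Real.log_mul (sigmaL _).2.ne' (sigmaL _).2.ne'

/-- If every element of `ρ(G)` is a translation, `τ_r` is the character of `G` that sends `g` to the
amplitude `ρ(g)(0)` of the translation `ρ(g)`. -/
def tauR (G : Subgroup PLHalf) (hG : ∀ g ∈ G, IsTranslation (rho g)) : Character G where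
  toFun g := rho (Additive.toMul g : G) 0
  map_zero' := by
    rw [toMul_zero, OneMemClass.coe_one, map_one]
    rfl
  map_add' g h := by
    rw [toMul_add, Subgroup.coe_mul, map_mul]
    obtain ⟨a, ha⟩ := hG _ (Additive.toMul g).2
    obtain ⟨b, hb⟩ := hG _ (Additive.toMul h).2
    rw [ha, hb]
    simp [AffineEquiv.mul_def]

/-- The kernel of `σ_ℓ`, restricted to `G`. -/
abbrev kerSigmaL (G : Subgroup PLHalf) : Subgroup G :=
  (sigmaL.comp G.subtype).ker

/-- The kernel of `τ_r` (as a subgroup of the multiplicatively written group `G`). -/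
abbrev kerTauR (G : Subgroup PLHalf) (hG : ∀ g ∈ G, IsTranslation (rho g)) : Subgroup G :=
  (AddMonoidHom.toMultiplicativeRight (tauR G hG)).ker

/-- `E(G)`: the set of rays represented by those among `χ_ℓ` and `-τ_r` that are non-zero. -/
def exceptionalSet (G : Subgroup PLHalf) (hG : ∀ g ∈ G, IsTranslation (rho g)) :
    Set (CharSphere G) :=
  {r | (∃ h : chiL G ≠ 0, r = rayOfNeZero ℝ (chiL G) h) ∨
    (∃ h : -tauR G hG ≠ 0, r = rayOfNeZero ℝ (-tauR G hG) h)}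

end PLHomeo

end

/-! Only the action of `G` on the open half line matters. Orbits are unbounded, since a bounded
orbit would have a supremum fixed by `G`. Each `g` is a translation by χ_ℓ(g) near 0 in the
coordinate log t, and a translation by τ_r(g) near ∞. `EndTranslations` records this with α = χ_ℓ
and ω = τ_r. Reversing the order replaces (α, ω) by (-ω, -α), so both exceptional rays are treated
as the ray of α.

Membership in Σ¹: it suffices to join to 1 all conjugates of one `m` with χ(m) > 0
(`PathAbove.of_conj`). Elements commuting with a reachable element of positive height are reachable
as soon as χ ≥ 0 on them, and commutation comes from supports pushed to opposite sides of a point.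
This settles the case where χ is positive somewhere on ker α and somewhere on ker ω. If χ vanishes
on ker α, either some p in ker ω has χ(p) > 0 > α(p), and its contraction towards the left end does
the job, or the torsion hypothesis forces χ to be a positive multiple of α. The case of ker ω is
dual.

Exclusion of α (`EndTranslations.notMem_Sigma1`): for generators that are translations on a fixed
left end, every path from 1 in the half space of α consists of elements whose inverses are
translations there too. Not all elements of the half space have this property. -/

namespace PLHomeo

/-! ### Paths in the half spaces of a Cayley graph -/

/-- `PathAbove X χ r g`: there is a path from `1` to `g` in the Cayley graph with respect to `X`
on which `χ` is at least `-r`. -/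
inductive PathAbove {G : Type*} [Group G] (X : Set G) (χ : Character G) (r : ℝ) : G → Prop
  | one : 0 ≤ r → PathAbove X χ r 1
  | step {g x : G} : PathAbove X χ r g → (x ∈ X ∨ x⁻¹ ∈ X) → 0 ≤ r + χ (.ofMul (g * x)) →
      PathAbove X χ r (g * x)

section Paths

variable {G : Type*} [Group G] {X : Set G} {χ : Character G}

theorem Character.map_mul (χ : Character G) (g h : G) :
    χ (.ofMul (g * h)) = χ (.ofMul g) + χ (.ofMul h) := by
  rw [ofMul_mul, map_add]

theorem Character.map_inv (χ : Character G) (g : G) : χ (.ofMul g⁻¹) = -χ (.ofMul g) := by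
  rw [ofMul_inv, map_neg]

theorem Character.map_pow (χ : Character G) (g : G) (n : ℕ) :
    χ (.ofMul (g ^ n)) = n * χ (.ofMul g) := by
  rw [ofMul_pow, map_nsmul, nsmul_eq_mul]

theorem Character.map_zpow (χ : Character G) (g : G) (n : ℤ) :
    χ (.ofMul (g ^ n)) = n * χ (.ofMul g) := by
  rw [ofMul_zpow, map_zsmul, zsmul_eq_mul]

theorem Character.map_one (χ : Character G) : χ (.ofMul (1 : G)) = 0 := by
  rw [ofMul_one, map_zero]

theorem Character.exists_pos_of_ne_zero (hχ : χ ≠ 0) : ∃ g : G, 0 < χ (.ofMul g) := by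
  by_contra! h
  refine hχ (AddMonoidHom.ext fun g => le_antisymm (h g.toMul) ?_)
  have := h g.toMul⁻¹
  rw [Character.map_inv] at this
  simpa using this

namespace PathAbove

theorem nonneg_add {r : ℝ} {g : G} (h : PathAbove X χ r g) : 0 ≤ r + χ (.ofMul g) := by
  cases h with
  | one h => simpa using h
  | step _ _ h => exact h

theorem mono {r s : ℝ} (hrs : r ≤ s) {g : G} (h : PathAbove X χ r g) : PathAbove X χ s g := by
  induction h with
  | one h => exact .one (h.trans hrs)
  | step _ hx h ih => exact ih.step hx (by linarith)

theorem mul {r s : ℝ} {g h : G} (hg : PathAbove X χ r g) (hh : PathAbove X χ s h)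
    (hs : s ≤ r + χ (.ofMul g)) : PathAbove X χ r (g * h) := by
  induction hh with
  | one _ => rwa [mul_one]
  | @step k x hk hx hkx ih =>
    rw [← mul_assoc]
    refine ih.step hx ?_
    rw [mul_assoc, Character.map_mul]
    linarith

theorem of_mem {x : G} (hx : x ∈ X ∨ x⁻¹ ∈ X) {r : ℝ} (hr : 0 ≤ r) (h : 0 ≤ r + χ (.ofMul x)) :
    PathAbove X χ r x := by
  simpa using (PathAbove.one hr).step hx (by simpa using h)

/-- This is the path to `g` read backwards and translated by `g⁻¹`, which lowers all heights by
χ(g). -/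
theorem inv {r : ℝ} {g : G} (h : PathAbove X χ r g) : PathAbove X χ (r + χ (.ofMul g)) g⁻¹ := by
  induction h with
  | one h => simpa using PathAbove.one h
  | @step k x hk hx hkx ih =>
    have h1 := hk.nonneg_add
    rw [mul_inv_rev]
    refine (of_mem (by simpa [or_comm] using hx) hkx ?_).mul ih (le_of_eq ?_) <;>
      rw [Character.map_mul, Character.map_inv] <;> linarith

theorem exists_of_closure_eq_top (hX : Subgroup.closure X = ⊤) (g : G) :
    ∃ r, PathAbove X χ r g := by
  have hg : g ∈ Subgroup.closure X := hX ▸ Subgroup.mem_top g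
  induction hg using Subgroup.closure_induction with
  | mem x hx =>
    exact ⟨|χ (.ofMul x)|, of_mem (.inl hx) (abs_nonneg _) (by linarith [neg_abs_le (χ (.ofMul x))])⟩
  | one => exact ⟨0, .one le_rfl⟩
  | mul x y _ _ hx hy =>
    obtain ⟨r, hr⟩ := hx
    obtain ⟨s, hs⟩ := hy
    exact ⟨max r (s - χ (.ofMul x)), (hr.mono (le_max_left _ _)).mul hs
      (by linarith [le_max_right r (s - χ (.ofMul x))])⟩
  | inv x _ hx =>
    obtain ⟨r, hr⟩ := hx
    exact ⟨_, hr.inv⟩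

theorem zero_mul {g h : G} (hg : PathAbove X χ 0 g) (hh : PathAbove X χ 0 h) :
    PathAbove X χ 0 (g * h) :=
  hg.mul hh hg.nonneg_add

theorem zero_pow {g : G} (hg : PathAbove X χ 0 g) (n : ℕ) : PathAbove X χ 0 (g ^ n) := by
  induction n with
  | zero => simpa using PathAbove.one le_rfl
  | succ n ih => rw [pow_succ]; exact ih.zero_mul hg

theorem zero_div {g h : G} (hg : PathAbove X χ 0 g) (hh : PathAbove X χ 0 h)
    (hgh : χ (.ofMul h) ≤ χ (.ofMul g)) : PathAbove X χ 0 (g * h⁻¹) :=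
  hg.mul hh.inv (by linarith)

theorem exists_pow_mul (hX : Subgroup.closure X = ⊤) {m : G} (hm : PathAbove X χ 0 m)
    (hm0 : 0 < χ (.ofMul m)) (g : G) : ∃ n : ℕ, PathAbove X χ 0 (m ^ n * g) := by
  obtain ⟨r, hr⟩ := exists_of_closure_eq_top (χ := χ) hX g
  obtain ⟨n, hn⟩ := exists_nat_ge (r / χ (.ofMul m))
  refine ⟨n, (hm.zero_pow n).mul hr ?_⟩
  rw [Character.map_pow, _root_.zero_add]
  rwa [div_le_iff₀ hm0] at hn

/-- Conjugating by a high power of `m` brings `g` into the component of `1`. -/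
theorem exists_conj_pow (hX : Subgroup.closure X = ⊤) {m : G} (hm : PathAbove X χ 0 m)
    (hm0 : 0 < χ (.ofMul m)) {g : G} (hg : 0 ≤ χ (.ofMul g)) :
    ∃ n : ℕ, PathAbove X χ 0 (m ^ n * g * (m ^ n)⁻¹) := by
  obtain ⟨n, hn⟩ := exists_pow_mul hX hm hm0 g
  exact ⟨n, hn.zero_div (hm.zero_pow n) (by rw [Character.map_mul]; linarith)⟩

/-- If `m` and its conjugate by `g⁻¹` lie in the component of `1`, then so does `g`. -/
theorem of_conj (hX : Subgroup.closure X = ⊤) {m g : G} (hm : PathAbove X χ 0 m)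
    (hm0 : 0 < χ (.ofMul m)) (hmg : PathAbove X χ 0 (g⁻¹ * m * g)) (hg : 0 ≤ χ (.ofMul g)) :
    PathAbove X χ 0 g := by
  obtain ⟨n, hn⟩ := exists_pow_mul hX hm hm0 g
  -- From `m ^ n * g` the reversed path of `(g⁻¹ * m * g) ^ n` leads down to `g`. It stays at height
  -- at least χ(g), because the forward path stays at height at least 0.
  have key : m ^ n * g * ((g⁻¹ * m * g) ^ n)⁻¹ = g := by
    have : (g⁻¹ * m * g) ^ n = g⁻¹ * m ^ n * g := by
      simpa using conj_pow (i := n) (a := g⁻¹) (b := m)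
    rw [this]; group
  rw [← key]
  refine hn.zero_div (hmg.zero_pow n) ?_
  simp only [Character.map_mul, Character.map_pow, Character.map_inv]
  linarith

theorem of_commute (hX : Subgroup.closure X = ⊤) {m g : G} (hm : PathAbove X χ 0 m)
    (hm0 : 0 < χ (.ofMul m)) (hmg : Commute m g) (hg : 0 ≤ χ (.ofMul g)) :
    PathAbove X χ 0 g := by
  refine of_conj hX hm hm0 ?_ hg
  rwa [mul_assoc, hmg.eq, inv_mul_cancel_left]

/-- Some generator or its inverse has positive height, as otherwise χ would vanish on `X` and hence
on `G`. -/
theorem exists_pos (hX : Subgroup.closure X = ⊤) (hχ : χ ≠ 0) :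
    ∃ t, PathAbove X χ 0 t ∧ 0 < χ (.ofMul t) := by
  by_contra! h
  have h0 : ∀ x ∈ X, χ (.ofMul x) = 0 := fun x hx => by
    by_contra hne
    rcases lt_or_gt_of_ne hne with hlt | hgt
    · have h1 : 0 < χ (.ofMul x⁻¹) := by rw [Character.map_inv]; linarith
      exact (h _ (of_mem (.inr (by simpa using hx)) le_rfl (by linarith))).not_gt h1
    · exact (h _ (of_mem (.inl hx) le_rfl (by linarith))).not_gt hgt
  refine hχ (AddMonoidHom.ext fun g => ?_)
  obtain ⟨g, rfl⟩ := Additive.ofMul.surjective g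
  have hg : g ∈ Subgroup.closure X := hX ▸ Subgroup.mem_top _
  change χ (.ofMul g) = 0
  induction hg using Subgroup.closure_induction with
  | mem x hx => exact h0 x hx
  | one => exact Character.map_one χ
  | mul x y _ _ hx hy => rw [Character.map_mul, hx, hy, add_zero]
  | inv x _ hx => rw [Character.map_inv, hx, neg_zero]

theorem reachable {g : G} (h : PathAbove X χ 0 g) :
    (cayleySubgraph X χ).Reachable ⟨1, (Character.map_one χ).ge⟩
      ⟨g, by simpa [nonnegSet] using h.nonneg_add⟩ := by
  induction h with
  | one _ => exact .refl _
  | @step k x hk hx hkx ih =>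
    refine ih.trans ?_
    by_cases h1 : k = k * x
    · simp only [← h1]; exact .refl _
    · refine SimpleGraph.Adj.reachable ?_
      rw [cayleySubgraph, SimpleGraph.comap_adj]
      simp only [Function.Embedding.subtype_apply, SimpleGraph.mulCayley_adj']
      refine ⟨h1, ?_⟩
      rcases hx with hx | hx
      · exact ⟨x, hx, .inl rfl⟩
      · exact ⟨x⁻¹, hx, .inr (by group)⟩

end PathAbove

/-- A ray lies in `Σ¹` if the conjugates of `m` are joined to `1` in the half space, for some `m` on
which the character is positive. -/
theorem rayOfNeZero_mem_Sigma1_of_pathAbove (hχ : χ ≠ 0)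
    (h : ∀ X : Set G, Subgroup.closure X = ⊤ →
      ∃ m, 0 < χ (.ofMul m) ∧ ∀ g : G, PathAbove X χ 0 (g⁻¹ * m * g)) :
    rayOfNeZero ℝ χ hχ ∈ Sigma1 G := by
  refine (rayOfNeZero_mem_Sigma1 χ hχ).2 fun X hX => ?_
  obtain ⟨m, hm0, hm⟩ := h X hX
  have key : ∀ v : nonnegSet χ, (cayleySubgraph X χ).Reachable ⟨1, (Character.map_one χ).ge⟩ v :=
    fun v => (PathAbove.of_conj hX (by simpa using hm 1) hm0 (hm v.1) v.2).reachable
  exact { preconnected := fun u v => (key u).symm.trans (key v)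
          nonempty := ⟨⟨1, (Character.map_one χ).ge⟩⟩ }

/-- A ray does not lie in `Σ¹` if some set `C` is, within the half space, closed under right
multiplication by the elements of a generating set and their inverses, but does not contain the
half space. -/
theorem rayOfNeZero_notMem_Sigma1 (hχ : χ ≠ 0) (hX : Subgroup.closure X = ⊤) {C : Set G}
    (h1 : 1 ∈ C) (hC : ∀ g ∈ C, 0 ≤ χ (.ofMul g) → ∀ x, (x ∈ X ∨ x⁻¹ ∈ X) → g * x ∈ C)
    {k : G} (hk : 0 ≤ χ (.ofMul k)) (hkC : k ∉ C) : rayOfNeZero ℝ χ hχ ∉ Sigma1 G := by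
  intro h
  have hconn := (rayOfNeZero_mem_Sigma1 χ hχ).1 h X hX
  obtain ⟨w⟩ := hconn.preconnected ⟨1, (Character.map_one χ).ge⟩ ⟨k, hk⟩
  have hw : ∀ u v : nonnegSet χ, (cayleySubgraph X χ).Walk u v → u.1 ∈ C → v.1 ∈ C := by
    intro u v p
    induction p with
    | nil => exact fun h => h
    | @cons u v w huv _ ih =>
      intro hu
      refine ih ?_
      rw [cayleySubgraph, SimpleGraph.comap_adj] at huv
      simp only [Function.Embedding.subtype_apply, SimpleGraph.mulCayley_adj'] at huv
      obtain ⟨-, x, hx, hux | hux⟩ := huv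
      · rw [← hux]; exact hC _ hu u.2 x (.inl hx)
      · rw [show v.1 = u.1 * x⁻¹ by rw [hux]; group]
        exact hC _ hu u.2 _ (.inr (by simpa using hx))
  exact hkC (hw _ _ w h1)

end Paths

/-! ### Ordered actions that are translations near both ends -/

/-- The group `G` acts faithfully and by increasing maps on the ordered set `Ω`, with unbounded
orbits.  In suitable coordinates, `g` is the translation with amplitude `α g` near the left end
of `Ω`, and the translation with amplitude `ω g` near the right end. -/
structure EndTranslations {G : Type*} [Group G] (Ω : Type*) [LinearOrder Ω] [MulAction G Ω]
    (α ω : Character G) : Prop where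
  strictMono : ∀ g : G, StrictMono fun x : Ω => g • x
  faithful : ∀ g : G, (∀ x : Ω, g • x = x) → g = 1
  exists_lt_smul : ∀ x y : Ω, ∃ g : G, y < g • x
  left : ∃ φ : Ω → ℝ, StrictMono φ ∧
    ∀ g : G, ∃ c : Ω, ∀ x ≤ c, φ (g • x) = φ x + α (.ofMul g)
  right : ∃ φ : Ω → ℝ, StrictMono φ ∧
    ∀ g : G, ∃ c : Ω, ∀ x, c ≤ x → φ (g • x) = φ x + ω (.ofMul g)

namespace EndTranslations

variable {G : Type*} [Group G] {Ω : Type*} [LinearOrder Ω] [MulAction G Ω]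
  {α ω χ : Character G}

theorem exists_smul_lt (H : EndTranslations Ω α ω) (x y : Ω) : ∃ g : G, g • x < y := by
  obtain ⟨g, hg⟩ := H.exists_lt_smul y x
  refine ⟨g⁻¹, ?_⟩
  simpa using H.strictMono g⁻¹ hg

theorem dual (H : EndTranslations Ω α ω) : EndTranslations Ωᵒᵈ (-ω) (-α) where
  strictMono g _ _ h := H.strictMono g h
  faithful := H.faithful
  exists_lt_smul x y := H.exists_smul_lt (OrderDual.ofDual x) (OrderDual.ofDual y)
  left := by
    obtain ⟨φ, hφ, h⟩ := H.right
    refine ⟨fun x => -φ (OrderDual.ofDual x), fun x y hxy => neg_lt_neg (hφ hxy), fun g => ?_⟩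
    obtain ⟨c, hc⟩ := h g
    refine ⟨OrderDual.toDual c, fun x hx => ?_⟩
    have := hc (OrderDual.ofDual x) hx
    change -φ (g • OrderDual.ofDual x) = -φ (OrderDual.ofDual x) + -ω (.ofMul g)
    rw [this]; ring
  right := by
    obtain ⟨φ, hφ, h⟩ := H.left
    refine ⟨fun x => -φ (OrderDual.ofDual x), fun x y hxy => neg_lt_neg (hφ hxy), fun g => ?_⟩
    obtain ⟨c, hc⟩ := h g
    refine ⟨OrderDual.toDual c, fun x hx => ?_⟩
    have := hc (OrderDual.ofDual x) hx
    change -φ (g • OrderDual.ofDual x) = -φ (OrderDual.ofDual x) + -α (.ofMul g)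
    rw [this]; ring

/-! ### Dynamics near the two ends, and commutation by disjoint supports -/

theorem exists_fix_le (H : EndTranslations Ω α ω) {g : G} (hg : α (.ofMul g) = 0) :
    ∃ c : Ω, ∀ x ≤ c, g • x = x := by
  obtain ⟨φ, hφ, h⟩ := H.left
  obtain ⟨c, hc⟩ := h g
  exact ⟨c, fun x hx => hφ.injective (by rw [hc x hx, hg, add_zero])⟩

theorem exists_fix_ge (H : EndTranslations Ω α ω) {g : G} (hg : ω (.ofMul g) = 0) :
    ∃ c : Ω, ∀ x, c ≤ x → g • x = x := by
  obtain ⟨φ, hφ, h⟩ := H.right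
  obtain ⟨c, hc⟩ := h g
  exact ⟨c, fun x hx => hφ.injective (by rw [hc x hx, hg, add_zero])⟩

theorem exists_smul_lt_self (H : EndTranslations Ω α ω) {g : G} (hg : α (.ofMul g) < 0) :
    ∃ c : Ω, ∀ x ≤ c, g • x < x := by
  obtain ⟨φ, hφ, h⟩ := H.left
  obtain ⟨c, hc⟩ := h g
  exact ⟨c, fun x hx => hφ.lt_iff_lt.1 (by rw [hc x hx]; linarith)⟩

theorem commute_of_fix (H : EndTranslations Ω α ω) {p q : G} {c d : Ω}
    (hp : ∀ x ≤ c, p • x = x) (hq : ∀ x, d ≤ x → q • x = x) (hdc : d ≤ c) : Commute p q := by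
  have key : ∀ x : Ω, p • q • x = q • p • x := fun x => by
    rcases le_total x c with hxc | hxc
    · have : q • x ≤ c := by
        have h : q • x ≤ q • c := (H.strictMono q).monotone hxc
        rwa [hq c hdc] at h
      rw [hp x hxc, hp _ this]
    · have : d ≤ p • x := by
        have h : p • c ≤ p • x := (H.strictMono p).monotone hxc
        rw [hp c le_rfl] at h
        exact hdc.trans h
      rw [hq x (hdc.trans hxc), hq _ this]
  have h1 := H.faithful ((q * p)⁻¹ * (p * q)) fun x => by
    rw [mul_smul, inv_smul_eq_iff, mul_smul, mul_smul, key]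
  exact (inv_mul_eq_one.1 h1).symm

theorem conj_fix_ge (H : EndTranslations Ω α ω) {q : G} {d : Ω}
    (hq : ∀ x, d ≤ x → q • x = x) (h : G) (x : Ω) (hx : h • d ≤ x) : (h * q * h⁻¹) • x = x := by
  have h1 := (H.strictMono h⁻¹).monotone hx
  simp only [inv_smul_smul] at h1
  rw [mul_smul, mul_smul, hq _ h1, smul_inv_smul]

/-- A chain of commuting elements: a reachable conjugate `p₁` of `p` and the target `g⁻¹ * p * g`
both fix a left end, while a conjugate of `q` can be supported inside the common fixed left end.
That conjugate commutes with both, so reachability passes from `p₁` to it and then to the target. -/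
theorem pathAbove_conj_of_pos_of_pos (H : EndTranslations Ω α ω) {X : Set G}
    (hX : Subgroup.closure X = ⊤) (hχ : χ ≠ 0) {p q : G} (hp : α (.ofMul p) = 0)
    (hq : ω (.ofMul q) = 0) (hχp : 0 < χ (.ofMul p)) (hχq : 0 < χ (.ofMul q)) (g : G) :
    PathAbove X χ 0 (g⁻¹ * p * g) := by
  obtain ⟨t, ht, ht0⟩ := PathAbove.exists_pos hX hχ
  obtain ⟨n, hn⟩ := PathAbove.exists_conj_pow hX ht ht0 hχp.le
  set p₁ := t ^ n * p * (t ^ n)⁻¹ with hp₁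
  obtain ⟨c₁, hc₁⟩ := H.exists_fix_le (g := p₁) (by
    simp only [hp₁, Character.map_mul, Character.map_inv]; linarith)
  obtain ⟨c₂, hc₂⟩ := H.exists_fix_le (g := g⁻¹ * p * g) (by
    simp only [Character.map_mul, Character.map_inv]; linarith)
  obtain ⟨d, hd⟩ := H.exists_fix_ge hq
  obtain ⟨h, hh⟩ := H.exists_smul_lt d (min c₁ c₂)
  have hfix := H.conj_fix_ge hd h
  have hpos : 0 < χ (.ofMul (h * q * h⁻¹)) := by
    simp only [Character.map_mul, Character.map_inv]; linarith
  have hq' : PathAbove X χ 0 (h * q * h⁻¹) := hn.of_commute hX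
    (by simp only [hp₁, Character.map_mul, Character.map_inv]; linarith)
    (H.commute_of_fix hc₁ hfix (hh.le.trans (min_le_left _ _))) hpos.le
  exact hq'.of_commute hX hpos (H.commute_of_fix hc₂ hfix (hh.le.trans (min_le_right _ _))).symm
    (by simp only [Character.map_mul, Character.map_inv]; linarith)

/-- A conjugate of `p` by a suitable `g` is supported where `u` is trivial, but `g` itself need not
be reachable. Conjugating by `p ^ n * g` repairs this: it is reachable for suitable `n`, and since
`p` moves points near the left end further left, the support of the conjugate stays where `u` is
trivial. -/
theorem pathAbove_of_contracting (H : EndTranslations Ω α ω) {X : Set G}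
    (hX : Subgroup.closure X = ⊤) {p u : G} (hp : PathAbove X χ 0 p) (hχp : 0 < χ (.ofMul p))
    (hαp : α (.ofMul p) < 0) (hωp : ω (.ofMul p) = 0) (hαu : α (.ofMul u) = 0)
    (hχu : 0 ≤ χ (.ofMul u)) : PathAbove X χ 0 u := by
  obtain ⟨d, hd⟩ := H.exists_fix_ge hωp
  obtain ⟨c, hc⟩ := H.exists_fix_le hαu
  obtain ⟨e, he⟩ := H.exists_smul_lt_self hαp
  obtain ⟨g, hg⟩ := H.exists_smul_lt d (min c e)
  obtain ⟨n, hn⟩ := PathAbove.exists_pow_mul hX hp hχp g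
  have hpow : ∀ k : ℕ, p ^ k • g • d ≤ g • d := fun k => by
    induction k with
    | zero => simp
    | succ k ih =>
      rw [pow_succ', mul_smul]
      exact (he _ (ih.trans (hg.le.trans (min_le_right _ _)))).le.trans ih
  have hpos : 0 < χ (.ofMul (p ^ n * g * p * (p ^ n * g)⁻¹)) := by
    rw [Character.map_mul, Character.map_mul (g := p ^ n * g), Character.map_inv]; linarith
  have hmem : PathAbove X χ 0 (p ^ n * g * p * (p ^ n * g)⁻¹) :=
    (hn.zero_mul hp).zero_div hn (by rw [Character.map_mul (g := p ^ n * g)]; linarith)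
  refine hmem.of_commute hX hpos (H.commute_of_fix hc (H.conj_fix_ge hd (p ^ n * g)) ?_).symm hχu
  rw [mul_smul]
  exact (hpow n).trans (hg.le.trans (min_le_left _ _))

theorem mem_Sigma1_of_pos_of_pos (H : EndTranslations Ω α ω) (hχ : χ ≠ 0) {p q : G}
    (hp : α (.ofMul p) = 0) (hq : ω (.ofMul q) = 0) (hχp : 0 < χ (.ofMul p))
    (hχq : 0 < χ (.ofMul q)) : rayOfNeZero ℝ χ hχ ∈ Sigma1 G :=
  rayOfNeZero_mem_Sigma1_of_pathAbove hχ fun _ hX =>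
    ⟨p, hχp, H.pathAbove_conj_of_pos_of_pos hX hχ hp hq hχp hχq⟩

theorem mem_Sigma1_of_pos_of_neg (H : EndTranslations Ω α ω) (hχ : χ ≠ 0) {p : G}
    (hχp : 0 < χ (.ofMul p)) (hαp : α (.ofMul p) < 0) (hωp : ω (.ofMul p) = 0) :
    rayOfNeZero ℝ χ hχ ∈ Sigma1 G := by
  refine rayOfNeZero_mem_Sigma1_of_pathAbove hχ fun X hX => ?_
  obtain ⟨t, ht, ht0⟩ := PathAbove.exists_pos hX hχ
  obtain ⟨n, hn⟩ := PathAbove.exists_conj_pow hX ht ht0 hχp.le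
  have hconj : ∀ ψ : Character G, ψ (.ofMul (t ^ n * p * (t ^ n)⁻¹)) = ψ (.ofMul p) := fun ψ => by
    simp only [Character.map_mul, Character.map_inv]; ring
  set m := t ^ n * p * (t ^ n)⁻¹
  refine ⟨m, by rwa [hconj], fun g => ?_⟩
  -- The conjugate is `m` times a commutator, and a commutator is killed by both α and χ, so
  -- `pathAbove_of_contracting` applies to it.
  have hcomm : ∀ ψ : Character G, ψ (.ofMul (m⁻¹ * g⁻¹ * m * g)) = 0 := fun ψ => by
    simp only [Character.map_mul, Character.map_inv]; ring
  have := hn.zero_mul (H.pathAbove_of_contracting hX hn (by rwa [hconj]) (by rwa [hconj])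
    (by rwa [hconj]) (hcomm α) (hcomm χ).ge)
  simpa [mul_assoc] using this

end EndTranslations

/-- A non-zero character that is positive only where `β` is positive represents the ray of `β`. -/
theorem rayOfNeZero_eq_of_pos {G : Type*} [Group G] {χ β : Character G} (hχ : χ ≠ 0)
    (h : ∀ g : G, 0 < χ (.ofMul g) → 0 < β (.ofMul g)) :
    ∃ hβ : β ≠ 0, rayOfNeZero ℝ χ hχ = rayOfNeZero ℝ β hβ := by
  obtain ⟨t, ht⟩ := Character.exists_pos_of_ne_zero hχ
  have hβt := h t ht
  have hβ : β ≠ 0 := fun h0 => by simp [h0] at hβt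
  have key : ∀ g : G, χ (.ofMul g) / χ (.ofMul t) ≤ β (.ofMul g) / β (.ofMul t) := fun g => by
    by_contra! hlt
    -- For a rational r = a/d strictly between the two quotients, the element g^d t^(-a) has χ > 0
    -- and β < 0.
    obtain ⟨r, hr1, hr2⟩ := exists_rat_btwn hlt
    have hd : (0 : ℝ) < r.den := by exact_mod_cast r.den_pos
    rw [Rat.cast_def, div_lt_div_iff₀ hβt hd] at hr1
    rw [Rat.cast_def, div_lt_div_iff₀ hd ht] at hr2
    have := h (g ^ (r.den : ℤ) * t ^ (-r.num)) (by
      rw [Character.map_mul, Character.map_zpow, Character.map_zpow]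
      push_cast; linarith)
    rw [Character.map_mul, Character.map_zpow, Character.map_zpow] at this
    push_cast at this
    linarith
  have key' : ∀ g : G, χ (.ofMul g) / χ (.ofMul t) = β (.ofMul g) / β (.ofMul t) := fun g => by
    refine le_antisymm (key g) ?_
    have := key g⁻¹
    rw [Character.map_inv, Character.map_inv, neg_div, neg_div] at this
    linarith
  refine ⟨hβ, (ray_eq_iff hχ hβ).2 (.inr (.inr ⟨_, _, hβt, ht, AddMonoidHom.ext fun g => ?_⟩))⟩
  have := key' g.toMul
  rw [div_eq_div_iff ht.ne' hβt.ne'] at this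
  simp only [AddMonoidHom.smul_apply, smul_eq_mul]
  simp only [ofMul_toMul] at this
  linarith

/-- Every element has a positive power in `ker α · ker ω`. -/
def TorsionModKer {G : Type*} [Group G] (α ω : Character G) : Prop :=
  ∀ g : G, ∃ k : ℕ, 0 < k ∧ ∃ a b : G,
    α (.ofMul a) = 0 ∧ ω (.ofMul b) = 0 ∧ g ^ k = a * b

theorem TorsionModKer.dual {G : Type*} [Group G] {α ω : Character G} (h : TorsionModKer α ω) :
    TorsionModKer (-ω) (-α) := fun g => by
  obtain ⟨k, hk, a, b, ha, hb, hab⟩ := h g⁻¹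
  refine ⟨k, hk, b⁻¹, a⁻¹, ?_, ?_, ?_⟩
  · rw [Character.map_inv]; simp [hb]
  · rw [Character.map_inv]; simp [ha]
  · rw [← mul_inv_rev, ← hab, inv_pow, inv_inv]

/-! ### The rays outside Σ¹ are exactly those of α and -ω -/

namespace EndTranslations

variable {G : Type*} [Group G] {Ω : Type*} [LinearOrder Ω] [MulAction G Ω]
  {α ω χ : Character G}

theorem mem_Sigma1_or_eq_of_vanish (H : EndTranslations Ω α ω) (htors : TorsionModKer α ω)
    (hχ : χ ≠ 0) (hv : ∀ g : G, α (.ofMul g) = 0 → χ (.ofMul g) = 0) :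
    rayOfNeZero ℝ χ hχ ∈ Sigma1 G ∨ ∃ h : α ≠ 0, rayOfNeZero ℝ χ hχ = rayOfNeZero ℝ α h := by
  by_cases hp : ∃ p : G, 0 < χ (.ofMul p) ∧ α (.ofMul p) < 0 ∧ ω (.ofMul p) = 0
  · obtain ⟨p, h1, h2, h3⟩ := hp
    exact .inl (H.mem_Sigma1_of_pos_of_neg hχ h1 h2 h3)
  · push Not at hp
    refine .inr (rayOfNeZero_eq_of_pos hχ fun g hg => ?_)
    -- As both α and χ vanish on `a`, the factor `b` in ker ω has k times the values of `g` under χ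
    -- and α. A negative α(g) would make `b` one of the excluded elements `p`.
    obtain ⟨k, hk, a, b, ha, hb, hab⟩ := htors g
    have hk' : (0 : ℝ) < k := by exact_mod_cast hk
    have h1 : k * χ (.ofMul g) = χ (.ofMul b) := by
      rw [← Character.map_pow, hab, Character.map_mul, hv a ha, zero_add]
    have h2 : k * α (.ofMul g) = α (.ofMul b) := by
      rw [← Character.map_pow, hab, Character.map_mul, ha, zero_add]
    refine lt_of_le_of_ne ?_ fun h0 => hg.ne' (hv g h0.symm)
    by_contra! hlt
    refine hp b (h1 ▸ mul_pos hk' hg) ?_ hb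
    rw [← h2]
    exact mul_neg_of_pos_of_neg hk' hlt

theorem mem_Sigma1_or_eq (H : EndTranslations Ω α ω) (htors : TorsionModKer α ω) (hχ : χ ≠ 0) :
    rayOfNeZero ℝ χ hχ ∈ Sigma1 G ∨ (∃ h : α ≠ 0, rayOfNeZero ℝ χ hχ = rayOfNeZero ℝ α h) ∨
      ∃ h : -ω ≠ 0, rayOfNeZero ℝ χ hχ = rayOfNeZero ℝ (-ω) h := by
  have hpos : ∀ g : G, χ (.ofMul g) ≠ 0 → 0 < χ (.ofMul g) ∨ 0 < χ (.ofMul g⁻¹) := fun g hg => by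
    rw [Character.map_inv, neg_pos]
    exact hg.lt_or_gt.symm
  have hker : ∀ β : Character G, (∀ g : G, β (.ofMul g) = 0 → χ (.ofMul g) = 0) ∨
      ∃ p : G, β (.ofMul p) = 0 ∧ 0 < χ (.ofMul p) := fun β => by
    by_contra! h
    obtain ⟨⟨g, hg, hg'⟩, hp⟩ := h
    rcases hpos g hg' with h | h
    · exact (hp g hg).not_gt h
    · exact (hp g⁻¹ (by rw [Character.map_inv, hg, neg_zero])).not_gt h
  rcases hker α with hα | ⟨p, hp, hχp⟩
  · rcases H.mem_Sigma1_or_eq_of_vanish htors hχ hα with h | h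
    · exact .inl h
    · exact .inr (.inl h)
  rcases hker ω with hω | ⟨q, hq, hχq⟩
  · rcases H.dual.mem_Sigma1_or_eq_of_vanish htors.dual hχ
      (fun g hg => hω g (by simpa using hg)) with h | h
    · exact .inl h
    · exact .inr (.inr h)
  exact .inl (H.mem_Sigma1_of_pos_of_pos hχ hp hq hχp hχq)

/-- Not all elements on which `α` is non-negative can be inverted by the translation formula on a
fixed left end of `Ω`. -/
theorem exists_not_translation (H : EndTranslations Ω α ω) (htors : TorsionModKer α ω)
    (hα : α ≠ 0) {φ : Ω → ℝ} (hφ : StrictMono φ)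
    (hloc : ∀ g : G, ∃ c : Ω, ∀ x ≤ c, φ (g • x) = φ x + α (.ofMul g)) (a : Ω) :
    ∃ k : G, 0 ≤ α (.ofMul k) ∧ ¬ ∀ x ≤ a, φ (k⁻¹ • x) = φ x - α (.ofMul k) := by
  by_contra! hall
  -- An element of ker α would fix everything to the left of `a`, and so would its conjugates. As
  -- every point can be moved to the left of `a`, it is trivial. Hence `G` embeds in ℝ and is
  -- abelian.
  have hker : ∀ g : G, α (.ofMul g) = 0 → g = 1 := fun g hg => by
    refine H.faithful g fun x => ?_
    obtain ⟨h, hh⟩ := H.exists_smul_lt x a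
    have h0 : α (.ofMul (h * g⁻¹ * h⁻¹)) = 0 := by
      simp only [Character.map_mul, Character.map_inv]; linarith
    have h1 := hφ.injective ((hall _ h0.ge _ hh.le).trans (by rw [h0, sub_zero]))
    simpa [mul_smul] using h1
  have hcomm : ∀ g h : G, g * h = h * g := fun g h => by
    refine (inv_mul_eq_one.1 (hker _ ?_)).symm
    simp only [Character.map_mul, Character.map_inv]; linarith
  have hω : ∀ g : G, ω (.ofMul g) = 0 := fun g => by
    obtain ⟨k, hk, a, b, ha, hb, hab⟩ := htors g
    rw [hker a ha, one_mul] at hab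
    rw [← hab, Character.map_pow] at hb
    exact (mul_eq_zero.1 hb).resolve_left (by exact_mod_cast hk.ne')
  -- Now ω = 0, so `t` fixes a point `d`. By commutativity it fixes the whole orbit of `d`, which
  -- meets the region where `t` is a translation by α(t) > 0.
  obtain ⟨t, ht⟩ := Character.exists_pos_of_ne_zero hα
  obtain ⟨c, hc⟩ := hloc t
  obtain ⟨d, hd⟩ := H.exists_fix_ge (hω t)
  obtain ⟨h, hh⟩ := H.exists_smul_lt d c
  have h1 := hc _ hh.le
  rw [← mul_smul, hcomm, mul_smul, hd d le_rfl] at h1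
  linarith

/-- The generating set consists of the elements that, together with their inverses, are translations
on the left end below `a`. It generates because conjugation by powers of a contracting `t` enlarges
the domain on which the translation formula holds. -/
theorem notMem_Sigma1 (H : EndTranslations Ω α ω) (htors : TorsionModKer α ω) (hα : α ≠ 0) :
    rayOfNeZero ℝ α hα ∉ Sigma1 G := by
  obtain ⟨φ, hφ, hloc⟩ := H.left
  obtain ⟨s, hs⟩ := Character.exists_pos_of_ne_zero hα
  obtain ⟨t, ht⟩ : ∃ t : G, α (.ofMul t) < 0 :=
    ⟨s⁻¹, by rw [Character.map_inv]; linarith⟩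
  obtain ⟨b, hb⟩ := hloc t
  have hpow : ∀ n : ℕ, ∀ x ≤ b, φ (t ^ n • x) = φ x + n * α (.ofMul t) := fun n x hx => by
    induction n with
    | zero => simp
    | succ n ih =>
      have : t ^ n • x ≤ b := by
        refine le_trans (hφ.le_iff_le.1 ?_) hx
        rw [ih]
        have := mul_nonpos_of_nonneg_of_nonpos (Nat.cast_nonneg (α := ℝ) n) ht.le
        linarith
      rw [pow_succ', mul_smul, hb _ this, ih]
      push_cast; ring
  have hpow_inv : ∀ n : ℕ, ∀ y, φ y ≤ φ (t ^ n • b) →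
      φ ((t ^ n)⁻¹ • y) = φ y - n * α (.ofMul t) := fun n y hy => by
    have h1 : (t ^ n)⁻¹ • y ≤ (t ^ n)⁻¹ • t ^ n • b :=
      (H.strictMono (t ^ n)⁻¹).monotone (hφ.le_iff_le.1 hy)
    rw [inv_smul_smul] at h1
    have h2 := hpow n _ h1
    rw [smul_inv_smul] at h2
    linarith
  have hta : φ (t • b) = φ b + α (.ofMul t) := hb b le_rfl
  -- Between `a` and `b` there is a margin |α(t)| in the coordinate φ. It lets `t⁻¹`, and elements
  -- shifting by at most |α(t)|, act on the points below `a` without leaving the region below `b`.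
  set a := t • b
  have hab : a ≤ b := hφ.le_iff_le.1 (by linarith)
  let X : Set G := {g | (∀ x ≤ a, φ (g • x) = φ x + α (.ofMul g)) ∧
    ∀ x ≤ a, φ (g⁻¹ • x) = φ x + α (.ofMul g⁻¹)}
  have hXinv : ∀ x, (x ∈ X ∨ x⁻¹ ∈ X) → x ∈ X := fun x hx => by
    rcases hx with hx | hx
    · exact hx
    · exact ⟨by simpa using hx.2, hx.1⟩
  have htX : t ∈ X := by
    refine ⟨fun x hx => hb x (hx.trans hab), fun x hx => ?_⟩
    have := hpow_inv 1 x (by rw [pow_one]; exact hφ.monotone hx)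
    rw [Character.map_inv]
    simp only [pow_one, Nat.cast_one, one_mul] at this
    linarith
  have hconj : ∀ g : G, α (.ofMul t) ≤ α (.ofMul g) → α (.ofMul g) ≤ 0 →
      ∃ n : ℕ, (t ^ n)⁻¹ * g * t ^ n ∈ X := fun g hg1 hg2 => by
    obtain ⟨c, hc⟩ := hloc g
    obtain ⟨c', hc'⟩ := hloc g⁻¹
    -- This `n` makes `t ^ n` carry everything below `a` to where both `g` and `g⁻¹` are
    -- translations.
    obtain ⟨n, hn⟩ := exists_nat_ge ((φ a - φ (min c c')) / -α (.ofMul t))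
    rw [div_le_iff₀ (by linarith)] at hn
    have hsmall : ∀ x ≤ a, t ^ n • x ≤ min c c' := fun x hx => by
      refine hφ.le_iff_le.1 ?_
      rw [hpow n x (hx.trans hab)]
      have := hφ.monotone hx
      linarith
    refine ⟨n, fun x hx => ?_, fun x hx => ?_⟩
    · have hx' := hφ.monotone hx
      have h1 := hc _ ((hsmall x hx).trans (min_le_left _ _))
      have h2 := hpow n x (hx.trans hab)
      rw [mul_smul, mul_smul, hpow_inv n _ (by rw [h1, h2, hpow n b le_rfl]; linarith), h1, h2]
      simp only [Character.map_mul, Character.map_inv]; ring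
    · have hx' := hφ.monotone hx
      have h1 := hc' _ ((hsmall x hx).trans (min_le_right _ _))
      have h2 := hpow n x (hx.trans hab)
      rw [Character.map_inv] at h1
      rw [show ((t ^ n)⁻¹ * g * t ^ n)⁻¹ = (t ^ n)⁻¹ * g⁻¹ * t ^ n by group, mul_smul, mul_smul,
        hpow_inv n _ (by rw [h1, h2, hpow n b le_rfl]; linarith), h1, h2]
      simp only [Character.map_mul, Character.map_inv]; ring
  have hX : Subgroup.closure X = ⊤ := by
    refine eq_top_iff.2 fun g _ => ?_
    have htc := Subgroup.subset_closure (k := X) htX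
    -- Multiplying by a power of `t` brings the value of α into [α(t), 0), the range that `hconj`
    -- can handle.
    obtain ⟨m, hm, -⟩ := existsUnique_add_zsmul_mem_Ico (neg_pos.2 ht) (α (.ofMul g)) (α (.ofMul t))
    rw [zsmul_eq_mul, add_neg_cancel] at hm
    have hv : α (.ofMul (g * t ^ (-m))) = α (.ofMul g) + m * -α (.ofMul t) := by
      rw [Character.map_mul, Character.map_zpow]; push_cast; ring
    obtain ⟨n, hn⟩ := hconj (g * t ^ (-m)) (hv ▸ hm.1) (hv ▸ hm.2.le)
    have h1 := (Subgroup.closure X).mul_mem ((Subgroup.closure X).mul_mem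
      ((Subgroup.closure X).mul_mem (pow_mem htc n) (Subgroup.subset_closure hn))
      (inv_mem (pow_mem htc n))) (zpow_mem htc m)
    convert h1 using 1
    group
  obtain ⟨k, hk, hkC⟩ := H.exists_not_translation htors hα hφ hloc a
  refine rayOfNeZero_notMem_Sigma1 hα hX
    (C := {g | ∀ x ≤ a, φ (g⁻¹ • x) = φ x - α (.ofMul g)}) ?_ ?_ hk hkC
  · intro x _
    simp
  · intro g hg hg0 y hy x hx
    have h1 := hg x hx
    -- Here the half space enters: since α(g) ≥ 0, `g⁻¹` moves points below `a` to the left, so the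
    -- translation formula for `y⁻¹` still applies.
    have h2 : g⁻¹ • x ≤ a := (hφ.le_iff_le.1 (by linarith)).trans hx
    rw [mul_inv_rev, mul_smul, (hXinv y hy).2 _ h2, h1, Character.map_mul, Character.map_inv]
    ring

end EndTranslations

open Filter Topology

/-! ### The action of a subgroup of `PL_o([0, ∞))` on the open half line -/

/-- The elements of `PL_o([0, ∞))` act on the open half line. -/
instance halfLineAction (G : Subgroup PLHalf) : MulAction G (Set.Ioi (0 : ℝ)) where
  smul g x := ⟨(g : PLHalf).1 x, by
    have := (g : PLHalf).2.1 x.2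
    rwa [map_zero_of_mem] at this⟩
  one_smul _ := rfl
  mul_smul _ _ _ := rfl

theorem eventually_eq_sigmaL_mul (g : PLHalf) :
    ∀ᶠ t in 𝓝[≥] (0 : ℝ), (g : ℝ ≃ₜ ℝ) t = (sigmaL g).1 * t := by
  obtain ⟨p, -, h⟩ := exists_pos_eventually_right g
  have h1 : HasDerivWithinAt (fun t : ℝ => p * t) p (Set.Ici 0) 0 := by
    simpa using ((hasDerivAt_id (0 : ℝ)).const_mul p).hasDerivWithinAt
  have h2 := h1.congr_of_eventuallyEq h (by rw [map_zero_of_mem]; simp)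
  have h3 : (sigmaL g).1 = p := h2.derivWithin (uniqueDiffOn_Ici 0 0 Set.self_mem_Ici)
  rwa [h3]

/-- If an orbit were bounded above, its supremum would be a positive number that no element of `G`
increases. Applying this to inverses, it would be fixed by `G`. -/
theorem IsIrreducible.exists_lt_smul {G : Subgroup PLHalf} (hirr : IsIrreducible G)
    (x y : Set.Ioi (0 : ℝ)) : ∃ g : G, y < g • x := by
  by_contra! h
  let O : Set ℝ := Set.range fun g : G => (g : PLHalf).1 x
  have hne : O.Nonempty := ⟨_, 1, rfl⟩
  have hlub : IsLUB O (sSup O) := isLUB_csSup hne ⟨y, by rintro _ ⟨g, rfl⟩; exact h g⟩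
  have hpos : 0 < sSup O := x.2.trans_le (hlub.1 ⟨1, rfl⟩)
  have hle : ∀ g : G, (g : PLHalf).1 (sSup O) ≤ sSup O := fun g => by
    have hg := (g : PLHalf).2.1
    have himage : (g : PLHalf).1 (sSup O) = sSup ((g : PLHalf).1 '' O) :=
      hg.monotone.map_csSup_of_continuousAt (g : PLHalf).1.continuous.continuousAt hne hlub.bddAbove
    rw [himage]
    refine csSup_le (hne.image _) ?_
    rintro _ ⟨_, ⟨k, rfl⟩, rfl⟩
    exact hlub.1 ⟨g * k, rfl⟩
  obtain ⟨g, hg, hne⟩ := hirr (sSup O) (by rwa [interior_Ici])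
  refine hne (le_antisymm (hle ⟨g, hg⟩) ?_)
  have h1 := g.2.1.monotone (hle ⟨g, hg⟩⁻¹)
  change g.1 (g.1.symm (sSup O)) ≤ g.1 (sSup O) at h1
  rwa [Homeomorph.apply_symm_apply] at h1

theorem IsIrreducible.endTranslations {G : Subgroup PLHalf} (hirr : IsIrreducible G)
    (hG : ∀ g ∈ G, IsTranslation (rho g)) :
    EndTranslations (Set.Ioi (0 : ℝ)) (chiL G) (tauR G hG) where
  strictMono g _ _ h := (g : PLHalf).2.1 h
  faithful g h := by
    refine Subtype.ext (Subtype.ext (Homeomorph.ext fun x => ?_))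
    change (g : PLHalf).1 x = x
    rcases lt_trichotomy x 0 with hx | rfl | hx
    · by_contra hne
      exact absurd ((g : PLHalf).2.2.2 hne) (not_le.2 hx)
    · exact map_zero_of_mem _
    · exact congrArg Subtype.val (h ⟨x, hx⟩)
  exists_lt_smul := hirr.exists_lt_smul
  left := by
    refine ⟨fun x => Real.log x, fun x _ h => Real.log_lt_log x.2 h, fun g => ?_⟩
    obtain ⟨c, hc, h⟩ := mem_nhdsGE_iff_exists_Icc_subset.1 (eventually_eq_sigmaL_mul (g : PLHalf))
    refine ⟨⟨c, hc⟩, fun x hx => ?_⟩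
    have h1 : (g : PLHalf).1 x = (sigmaL (g : PLHalf)).1 * x := h ⟨x.2.le, hx⟩
    change Real.log ((g : PLHalf).1 x) = Real.log x + Real.log (sigmaL (g : PLHalf)).1
    rw [h1, Real.log_mul (sigmaL _).2.ne' x.2.ne', add_comm]
  right := by
    refine ⟨fun x => x, fun _ _ h => h, fun g => ?_⟩
    obtain ⟨c, h⟩ := eventually_atTop.1 (rho_spec (g : PLHalf))
    refine ⟨⟨max c 1, Set.mem_Ioi.2 (zero_lt_one.trans_le (le_max_right c 1))⟩, fun x hx => ?_⟩
    obtain ⟨d, hd⟩ := hG _ g.2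
    have h1 : (g : PLHalf).1 x = rho g x := h x ((le_max_left c 1).trans hx)
    change (g : PLHalf).1 x = x + rho g 0
    rw [h1, hd]
    simp [add_comm]

theorem torsionModKer_of_isMulTorsion {G : Subgroup PLHalf}
    (hG : ∀ g ∈ G, IsTranslation (rho g))
    (htors : IsMulTorsion (G ⧸ (kerSigmaL G ⊔ kerTauR G hG))) :
    TorsionModKer (chiL G) (tauR G hG) := fun g => by
  obtain ⟨k, hk, h⟩ := isOfFinOrder_iff_pow_eq_one.1 (htors (QuotientGroup.mk g))
  rw [← QuotientGroup.mk_pow, QuotientGroup.eq_one_iff] at h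
  -- The join of the two kernels is their product set, because the left one is normal.
  obtain ⟨a, ha, b, hb, hab⟩ := Subgroup.mem_sup_of_normal_left.1 h
  refine ⟨k, hk, a, b, ?_, hb, hab.symm⟩
  have ha' : sigmaL (a : PLHalf) = 1 := ha
  change Real.log (sigmaL (a : PLHalf)).1 = 0
  rw [ha']
  exact Real.log_one

end PLHomeo

theorem theorem1p2 (G : Subgroup PLHomeo.PLHalf)
    (hG : ∀ g ∈ G, PLHomeo.IsTranslation (PLHomeo.rho g))
    (hirr : PLHomeo.IsIrreducible G)
    (htors : IsMulTorsion (G ⧸ (PLHomeo.kerSigmaL G ⊔ PLHomeo.kerTauR G hG))) :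
    PLHomeo.Sigma1 G = Set.univ \ PLHomeo.exceptionalSet G hG := by
  have H := hirr.endTranslations hG
  have htors' := PLHomeo.torsionModKer_of_isMulTorsion hG htors
  refine Set.Subset.antisymm (fun r hr => ⟨Set.mem_univ r, ?_⟩) ?_
  · rintro (⟨h, rfl⟩ | ⟨h, rfl⟩)
    · exact H.notMem_Sigma1 htors' h hr
    · exact H.dual.notMem_Sigma1 htors'.dual h hr
  · rintro r ⟨-, hr⟩
    induction r using Module.Ray.ind with
    | h χ hχ => exact (H.mem_Sigma1_or_eq htors' hχ).resolve_right hr
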